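/- For $n\in\mathbb{N}$ let $K_n$ be the complete graph on the vertex set $[n]=\{1,\dots,n\}$, with edge set $E(K_n)$ the set of all 2-element subsets of $[n]$. The metric polytope $\mathcal{M}_n\subseteq[0,1]^{E(K_n)}$ is the set of all $d\in[0,1]^{E(K_n)}$ that satisfy the triangle inequality $d(\{i,k\})\le d(\{i,j\})+d(\{j,k\})$ for all distinct $i,j,k\in[n]$. Then, as $n\to\infty$, the $\binom n2$-dimensional Lebesgue volume of $\mathcal{M}_n$ satisfies $$\mathrm{vol}(\mathcal{M}_n)=\left(\tfrac12\right)^{\binom n2+o(n^2)}.$$ That is, there is a function $r:\mathbb{N}\to\mathbb{R}$ with $r(n)/n^2\to0$ as $n\to\infty$ such that $\mathrm{vol}(\mathcal{M}_n)=(1/2)^{\binom n2+r(n)}$ for every $n$. -/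

import Mathlib

open MeasureTheory Asymptotics

/-- The edge set `E(K_n)` of the complete graph on `n` vertices. -/
abbrev CompleteEdge (n : ℕ) : Type := (⊤ : SimpleGraph (Fin n)).edgeSet

/-- The edge of `K_n` joining two distinct vertices `i` and `j`. -/
def completeEdge {n : ℕ} (i j : Fin n) (h : i ≠ j) : CompleteEdge n :=
  ⟨s(i, j), (SimpleGraph.mem_edgeSet _).2 ((SimpleGraph.top_adj i j).2 h)⟩

/-- The metric polytope `M_n`: the set of all weightings `d` of the edges of `K_n` with values in
`[0, 1]` that satisfy the triangle inequality `d(ik) ≤ d(ij) + d(jk)` for all triples of distinct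
vertices `i, j, k`. -/
def metricPolytope (n : ℕ) : Set (CompleteEdge n → ℝ) :=
  {d | (∀ e, d e ∈ Set.Icc (0 : ℝ) 1) ∧
    ∀ (i j k : Fin n) (hij : i ≠ j) (hjk : j ≠ k) (hik : i ≠ k),
      d (completeEdge i k hik) ≤ d (completeEdge i j hij) + d (completeEdge j k hjk)}

/-! Lower bound: the cube with all weights in [1/2, 1] lies in the polytope, since 1 ≤ 1/2 + 1/2.

Upper bound: rounding distances down to multiples of 1/N gives an (N+1)-colouring of pairs that
obeys the triangle inequality up to 1. Weak (Frieze–Kannan) regularity, applied to all colour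
classes at once (`exists_isCutRegular`), yields a vertex partition whose number of cells is bounded
independently of n. The palette of a pair of cells consists of the colours of density at least η
there, so few pairs have a colour outside their palette. If three palettes admitted a colour triple
violating the rounded triangle inequality, the averaged densities would predict such triangles,
while the colouring has none; by the counting lemma `sum_triangle_le` this affects few vertex
triples. On the others the palette sizes add up to at most about 3N/2 (`card_add_card_add_card_le`),
so an average palette has about N/2 colours (`exists_palettes`).

For fixed parameters there are only exp(O(n)) choices of partition and palettes. Each confines
nearly every coordinate to a set of measure about 1/2 on average, so a convexity bound on the
product and a union bound finish the proof (`volume_metricPolytope_le`). -/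

/-! ### Averaging over fibres and its energy -/

section CondAvg

open Finset

variable {α β γ : Type*} [Fintype α] [DecidableEq β] [DecidableEq γ]

/-- The average of `W` over the fibre of `ψ` through `a`. -/
noncomputable def fiberAverage (ψ : α → β) (W : α → ℝ) (a : α) : ℝ :=
  (∑ a' with ψ a' = ψ a, W a') / (#{a' | ψ a' = ψ a} : ℝ)

theorem fiberAverage_congr (ψ : α → β) (W : α → ℝ) {a b : α} (h : ψ a = ψ b) :
    fiberAverage ψ W a = fiberAverage ψ W b := by
  simp only [fiberAverage, h]

theorem card_fiber_pos (ψ : α → β) (a : α) : (0 : ℝ) < (#{a' | ψ a' = ψ a} : ℝ) := by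
  exact_mod_cast Finset.card_pos.2 ⟨a, by simp⟩

theorem fiberAverage_nonneg (ψ : α → β) {W : α → ℝ} (hW : ∀ a, 0 ≤ W a) (a : α) :
    0 ≤ fiberAverage ψ W a :=
  div_nonneg (Finset.sum_nonneg fun _ _ => hW _) (card_fiber_pos ψ a).le

theorem sum_fiberAverage_eq_one {C : Type*} [Fintype C] (ψ : α → β) {W : C → α → ℝ}
    (hW : ∀ a, ∑ c, W c a = 1) (a : α) : ∑ c, fiberAverage ψ (W c) a = 1 := by
  simp only [fiberAverage]
  rw [← Finset.sum_div, Finset.sum_comm, div_eq_one_iff_eq (card_fiber_pos ψ a).ne']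
  simp [hW]

/-- Averaging is an orthogonal projection, and `f` lies in its range. -/
theorem sum_fiberAverage_mul (ψ : α → β) (W : α → ℝ) {f : α → ℝ}
    (hf : ∀ a b, ψ a = ψ b → f a = f b) :
    ∑ a, fiberAverage ψ W a * f a = ∑ a, W a * f a := by
  have h1 : ∀ a, fiberAverage ψ W a * f a =
      ∑ a', if ψ a' = ψ a then W a' * f a' / (#{x | ψ x = ψ a'} : ℝ) else 0 := by
    intro a
    rw [← Finset.sum_filter, fiberAverage, div_mul_eq_mul_div, Finset.sum_mul, Finset.sum_div]
    refine Finset.sum_congr rfl fun a' ha' => ?_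
    have h : ψ a' = ψ a := by simpa using ha'
    rw [hf a' a h, h]
  simp only [h1]
  rw [Finset.sum_comm]
  refine Finset.sum_congr rfl fun a' _ => ?_
  rw [← Finset.sum_filter, Finset.sum_const, nsmul_eq_mul]
  have h2 : (#{x | ψ a' = ψ x} : ℝ) = (#{x | ψ x = ψ a'} : ℝ) := by
    simp only [eq_comm]
  rw [h2, mul_div_cancel₀ _ (card_fiber_pos ψ a').ne']

/-- The energy of the averages of `W` over the fibres of `ψ`. -/
noncomputable def fiberEnergy (ψ : α → β) (W : α → ℝ) : ℝ := ∑ a, fiberAverage ψ W a ^ 2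

/-- Pythagoras for nested projections: `h` says that `ψ'` refines `ψ`. -/
theorem sum_sq_sub_fiberAverage (ψ : α → β) (ψ' : α → γ) (W : α → ℝ)
    (h : ∀ a b, ψ' a = ψ' b → ψ a = ψ b) :
    ∑ a, (fiberAverage ψ' W a - fiberAverage ψ W a) ^ 2 =
      fiberEnergy ψ' W - fiberEnergy ψ W := by
  have h1 := sum_fiberAverage_mul ψ' W (f := fiberAverage ψ W)
    fun a b hab => fiberAverage_congr ψ W (h a b hab)
  have h2 := sum_fiberAverage_mul ψ W (f := fiberAverage ψ W)
    fun a b hab => fiberAverage_congr ψ W hab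
  have h3 : ∑ a, fiberAverage ψ' W a * fiberAverage ψ W a = fiberEnergy ψ W := by
    rw [h1, ← h2, fiberEnergy]
    exact Finset.sum_congr rfl fun a _ => (sq _).symm
  have h4 : ∀ a, (fiberAverage ψ' W a - fiberAverage ψ W a) ^ 2 = fiberAverage ψ' W a ^ 2
      - 2 * (fiberAverage ψ' W a * fiberAverage ψ W a) + fiberAverage ψ W a ^ 2 := fun a => by ring
  simp only [h4, Finset.sum_add_distrib, Finset.sum_sub_distrib, ← Finset.mul_sum, h3]
  simp only [fiberEnergy]
  ring

theorem fiberEnergy_mono (ψ : α → β) (ψ' : α → γ) (W : α → ℝ)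
    (h : ∀ a b, ψ' a = ψ' b → ψ a = ψ b) : fiberEnergy ψ W ≤ fiberEnergy ψ' W := by
  have := sum_sq_sub_fiberAverage ψ ψ' W h
  have h2 : 0 ≤ ∑ a, (fiberAverage ψ' W a - fiberAverage ψ W a) ^ 2 :=
    Finset.sum_nonneg fun _ _ => sq_nonneg _
  linarith

/-- Cauchy–Schwarz after projecting to the finer partition: a test function correlated with the
error forces an energy gain once the partition resolves it. -/
theorem sq_sum_sub_fiberAverage_mul_le (ψ : α → β) (ψ' : α → γ) (W : α → ℝ)
    (h : ∀ a b, ψ' a = ψ' b → ψ a = ψ b) {f : α → ℝ} (hf : ∀ a b, ψ' a = ψ' b → f a = f b)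
    (hf1 : ∀ a, f a ^ 2 ≤ 1) :
    (∑ a, (W a - fiberAverage ψ W a) * f a) ^ 2 ≤
      (fiberEnergy ψ' W - fiberEnergy ψ W) * Fintype.card α := by
  have h1 : ∑ a, (W a - fiberAverage ψ W a) * f a =
      ∑ a, (fiberAverage ψ' W a - fiberAverage ψ W a) * f a := by
    simp only [sub_mul, Finset.sum_sub_distrib, sum_fiberAverage_mul ψ' W hf]
  rw [h1, ← sum_sq_sub_fiberAverage ψ ψ' W h]
  refine (Finset.sum_mul_sq_le_sq_mul_sq _ _ _).trans ?_
  refine mul_le_mul_of_nonneg_left ?_ (Finset.sum_nonneg fun _ _ => sq_nonneg _)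
  refine (Finset.sum_le_sum fun a _ => hf1 a).trans ?_
  simp

/-- At each point the averages form a probability vector. The bound does not grow with the number of
kernels, so neither does the number of refinement steps. -/
theorem sum_fiberEnergy_le {C : Type*} [Fintype C] (ψ : α → β) {W : C → α → ℝ}
    (h0 : ∀ c a, 0 ≤ W c a) (h1 : ∀ a, ∑ c, W c a = 1) :
    ∑ c, fiberEnergy ψ (W c) ≤ Fintype.card α := by
  simp only [fiberEnergy]
  rw [Finset.sum_comm]
  have h2 : ∀ a, ∑ c, fiberAverage ψ (W c) a ^ 2 ≤ 1 := by
    intro a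
    rw [← sum_fiberAverage_eq_one ψ h1 a]
    refine Finset.sum_le_sum fun c _ => ?_
    have h3 := fiberAverage_nonneg ψ (h0 c) a
    have h4 : fiberAverage ψ (W c) a ≤ 1 := by
      rw [← sum_fiberAverage_eq_one ψ h1 a]
      exact Finset.single_le_sum (f := fun c => fiberAverage ψ (W c) a)
        (fun c _ => fiberAverage_nonneg ψ (h0 c) a) (Finset.mem_univ c)
    nlinarith
  refine (Finset.sum_le_sum fun a _ => h2 a).trans ?_
  simp

end CondAvg

/-! ### Weak regularity for a family of kernels -/

section WeakRegularity

open Finset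

variable {V C : Type*} [Fintype V] [Fintype C]

/-- All the kernels `W c` are `ε`-close in cut norm to their averages over the cells of the
partition `π`. -/
def IsCutRegular (ε : ℝ) (W : C → V × V → ℝ) (π : V → ℕ) : Prop :=
  ∀ c, ∀ S T : Set V, |∑ a : V × V, (W c a - fiberAverage (Prod.map π π) (W c) a) *
    (S.indicator 1 a.1 * T.indicator 1 a.2)| ≤ ε * (Fintype.card V : ℝ) ^ 2

theorem exists_refinement_energy_increment {ε : ℝ} (hε : 0 < ε) (W : C → V × V → ℝ) (π : V → ℕ)
    (hπ : ¬ IsCutRegular ε W π) :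
    ∃ π' : V → ℕ, (∀ v, π' v / 4 = π v) ∧
      ∑ c, fiberEnergy (Prod.map π π) (W c) + ε ^ 2 * (Fintype.card V : ℝ) ^ 2 ≤
        ∑ c, fiberEnergy (Prod.map π' π') (W c) := by
  classical
  unfold IsCutRegular at hπ
  push Not at hπ
  obtain ⟨c, S, T, hc⟩ := hπ
  -- `b` records membership in the two witness sets; as a base-4 digit appended to `π` it gives a
  -- refinement from which division by 4 recovers `π`.
  let b (v : V) : ℕ := (if v ∈ S then 2 else 0) + (if v ∈ T then 1 else 0)
  have hb : ∀ v, b v < 4 := fun v => by simp only [b]; split_ifs <;> omega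
  let π' (v : V) : ℕ := 4 * π v + b v
  have hdiv : ∀ v, π' v / 4 = π v := fun v => by have := hb v; simp only [π']; omega
  have href : ∀ x y : V × V, Prod.map π' π' x = Prod.map π' π' y →
      Prod.map π π x = Prod.map π π y := by
    rintro ⟨x1, x2⟩ ⟨y1, y2⟩ h
    simp only [Prod.map_apply, Prod.mk.injEq] at h ⊢
    rw [← hdiv, ← hdiv x2, h.1, h.2, hdiv, hdiv]
    exact ⟨rfl, rfl⟩
  have hbb : ∀ x y, π' x = π' y → b x = b y := fun x y h => by
    have h2 : π x = π y := by rw [← hdiv, h, hdiv]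
    simp only [π', h2] at h
    omega
  have hS : ∀ x y, π' x = π' y → (S.indicator 1 x : ℝ) = S.indicator 1 y := fun x y h => by
    have := hbb x y h
    simp only [b] at this
    by_cases h1 : x ∈ S <;> by_cases h2 : y ∈ S <;> simp [h1, h2] at this ⊢ <;>
      split_ifs at this <;> omega
  have hT : ∀ x y, π' x = π' y → (T.indicator 1 x : ℝ) = T.indicator 1 y := fun x y h => by
    have := hbb x y h
    simp only [b] at this
    by_cases h1 : x ∈ T <;> by_cases h2 : y ∈ T <;> simp [h1, h2] at this ⊢ <;>
      split_ifs at this <;> omega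
  refine ⟨π', hdiv, ?_⟩
  have key := sq_sum_sub_fiberAverage_mul_le (Prod.map π π) (Prod.map π' π') (W c) href
    (f := fun a => S.indicator 1 a.1 * T.indicator 1 a.2)
    (by
      rintro ⟨x1, x2⟩ ⟨y1, y2⟩ h
      simp only [Prod.map_apply, Prod.mk.injEq] at h
      simp only [hS _ _ h.1, hT _ _ h.2])
    (by
      intro a
      by_cases h1 : a.1 ∈ S <;> by_cases h2 : a.2 ∈ T <;> simp [h1, h2])
  have h1 : (ε * (Fintype.card V : ℝ) ^ 2) ^ 2 <
      (∑ a : V × V, (W c a - fiberAverage (Prod.map π π) (W c) a) *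
        (S.indicator 1 a.1 * T.indicator 1 a.2)) ^ 2 := by
    rw [sq_lt_sq, abs_of_nonneg (by positivity)]
    exact hc
  have h2 := h1.trans_le key
  rw [Fintype.card_prod, Nat.cast_mul, ← sq] at h2
  have h3 : ε ^ 2 * (Fintype.card V : ℝ) ^ 2 <
      fiberEnergy (Prod.map π' π') (W c) - fiberEnergy (Prod.map π π) (W c) := by
    refine lt_of_mul_lt_mul_right (a := (Fintype.card V : ℝ) ^ 2) ?_ (by positivity)
    calc _ = (ε * (Fintype.card V : ℝ) ^ 2) ^ 2 := by ring
      _ < _ := h2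
  have h4 : fiberEnergy (Prod.map π' π') (W c) - fiberEnergy (Prod.map π π) (W c) ≤
      ∑ c, (fiberEnergy (Prod.map π' π') (W c) - fiberEnergy (Prod.map π π) (W c)) :=
    Finset.single_le_sum (f := fun c => fiberEnergy (Prod.map π' π') (W c) -
      fiberEnergy (Prod.map π π) (W c))
      (fun c _ => sub_nonneg.2 (fiberEnergy_mono _ _ (W c) href)) (Finset.mem_univ c)
  rw [Finset.sum_sub_distrib] at h4
  linarith

/-- Each failure of regularity gains energy more than ε²|V|², while the total is at most |V|²; hence
fewer than K refinements occur, each costing a factor 4 in the number of labels. -/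
theorem exists_isCutRegular {ε : ℝ} (hε : 0 < ε) {K : ℕ} (hK : 1 < K * ε ^ 2)
    {W : C → V × V → ℝ} (h0 : ∀ c a, 0 ≤ W c a) (h1 : ∀ a, ∑ c, W c a = 1) :
    ∃ π : V → ℕ, (∀ v, π v < 4 ^ K) ∧ IsCutRegular ε W π := by
  rcases isEmpty_or_nonempty V with hV | hV
  · exact ⟨fun _ => 0, fun v => isEmptyElim v, fun c S T => by simp⟩
  have hind : ∀ j : ℕ, ∃ π : V → ℕ, (∀ v, π v < 4 ^ j) ∧ (IsCutRegular ε W π ∨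
      j * (ε ^ 2 * (Fintype.card V : ℝ) ^ 2) ≤ ∑ c, fiberEnergy (Prod.map π π) (W c)) := by
    intro j
    induction j with
    | zero =>
      refine ⟨fun _ => 0, fun v => by simp, Or.inr ?_⟩
      simp only [Nat.cast_zero, zero_mul]
      exact Finset.sum_nonneg fun c _ => Finset.sum_nonneg fun a _ => sq_nonneg _
    | succ j ih =>
      obtain ⟨π, hπ, h⟩ := ih
      by_cases hreg : IsCutRegular ε W π
      · exact ⟨π, fun v => (hπ v).trans (Nat.pow_lt_pow_right (by norm_num) j.lt_succ_self),
          Or.inl hreg⟩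
      · obtain ⟨π', hdiv, hE⟩ := exists_refinement_energy_increment hε W π hreg
        refine ⟨π', fun v => ?_, Or.inr ?_⟩
        · have h2 := hπ v
          rw [← hdiv v] at h2
          rw [pow_succ]
          omega
        · have h2 := h.resolve_left hreg
          push_cast
          linarith
  obtain ⟨π, hπ, h⟩ := hind K
  refine ⟨π, hπ, h.resolve_right fun h2 => ?_⟩
  have h3 := h2.trans (sum_fiberEnergy_le (Prod.map π π) h0 h1)
  rw [Fintype.card_prod, Nat.cast_mul] at h3
  have hpos : (0 : ℝ) < (Fintype.card V : ℝ) ^ 2 := by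
    have : 0 < Fintype.card V := Fintype.card_pos
    positivity
  nlinarith

/-- A kernel that has small sums on all rectangles has small integrals against products of
`[0, 1]`-valued functions. -/
theorem sum_mul_mul_le_of_rectangles {B : ℝ} (U : V × V → ℝ)
    (hU : ∀ S T : Set V, ∑ a : V × V, U a * (S.indicator 1 a.1 * T.indicator 1 a.2) ≤ B)
    {f g : V → ℝ} (hf0 : ∀ v, 0 ≤ f v) (hf1 : ∀ v, f v ≤ 1) (hg0 : ∀ v, 0 ≤ g v)
    (hg1 : ∀ v, g v ≤ 1) : ∑ u, ∑ v, U (u, v) * (f u * g v) ≤ B := by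
  classical
  have aux : ∀ (x h : V → ℝ), (∀ v, 0 ≤ h v) → (∀ v, h v ≤ 1) →
      ∑ v, x v * h v ≤ ∑ v, x v * Set.indicator {v | 0 < x v} 1 v := by
    intro x h hh0 hh1
    refine Finset.sum_le_sum fun v _ => ?_
    by_cases hx : 0 < x v
    · simp only [Set.indicator, Set.mem_ofPred_eq, hx, if_true, Pi.one_apply]
      exact mul_le_mul_of_nonneg_left (hh1 v) hx.le
    · simp only [Set.indicator, Set.mem_ofPred_eq, hx, if_false, mul_zero]
      exact mul_nonpos_of_nonpos_of_nonneg (not_lt.1 hx) (hh0 v)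
  -- A form linear in each argument is maximised at indicators: round `f` to the set where its
  -- coefficient is positive, then `g`.
  set S : Set V := {u | 0 < ∑ v, U (u, v) * g v} with hS
  set T : Set V := {v | 0 < ∑ u, U (u, v) * S.indicator 1 u} with hT
  calc ∑ u, ∑ v, U (u, v) * (f u * g v)
      = ∑ u, (∑ v, U (u, v) * g v) * f u := by
        refine Finset.sum_congr rfl fun u _ => ?_
        rw [Finset.sum_mul]
        exact Finset.sum_congr rfl fun v _ => by ring
    _ ≤ ∑ u, (∑ v, U (u, v) * g v) * S.indicator 1 u := aux _ _ hf0 hf1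
    _ = ∑ v, (∑ u, U (u, v) * S.indicator 1 u) * g v := by
        simp only [Finset.sum_mul]
        rw [Finset.sum_comm]
        exact Finset.sum_congr rfl fun v _ => Finset.sum_congr rfl fun u _ => by ring
    _ ≤ ∑ v, (∑ u, U (u, v) * S.indicator 1 u) * T.indicator 1 v := aux _ _ hg0 hg1
    _ = ∑ a : V × V, U a * (S.indicator 1 a.1 * T.indicator 1 a.2) := by
        rw [Fintype.sum_prod_type_right]
        simp only [Finset.sum_mul, mul_assoc]
    _ ≤ B := hU S T

end WeakRegularity

/-! ### Triangle counting and palettes -/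

section Counting

open Finset

variable {V : Type*} [Fintype V]

theorem fiberAverage_swap {β : Type*} [DecidableEq β] (π : V → β) {W : V × V → ℝ}
    (hW : ∀ a, W a.swap = W a) (a : V × V) :
    fiberAverage (Prod.map π π) W a.swap = fiberAverage (Prod.map π π) W a := by
  have h : ∀ f : V × V → ℝ, (∀ a, f a.swap = f a) →
      ∑ a' with Prod.map π π a' = Prod.map π π a.swap, f a' =
        ∑ a' with Prod.map π π a' = Prod.map π π a, f a' := by
    intro f hf
    refine Finset.sum_equiv (Equiv.prodComm V V) ?_ ?_
    · obtain ⟨a1, a2⟩ := a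
      rintro ⟨x, y⟩
      simp [and_comm]
    · intro x _
      exact (hf x).symm
  have h1 := h (fun _ => 1) fun _ => rfl
  simp only [Finset.sum_const, nsmul_eq_mul, mul_one] at h1
  rw [fiberAverage, fiberAverage, h W hW, h1]

/-- The triangle counting lemma for kernels that are close in cut norm to their averages. -/
theorem sum_triangle_le {B : ℝ} {W q : Fin 3 → V × V → ℝ} (hW0 : ∀ i a, 0 ≤ W i a)
    (hW1 : ∀ i a, W i a ≤ 1) (hq0 : ∀ i a, 0 ≤ q i a) (hq1 : ∀ i a, q i a ≤ 1)
    (hB : ∀ i, ∀ S T : Set V,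
      ∑ a : V × V, (q i a - W i a) * (S.indicator 1 a.1 * T.indicator 1 a.2) ≤ B) :
    ∑ u, ∑ v, ∑ w, q 0 (u, v) * q 1 (v, w) * q 2 (u, w) ≤
      ∑ u, ∑ v, ∑ w, W 0 (u, v) * W 1 (v, w) * W 2 (u, w) + 3 * (Fintype.card V * B) := by
  have hconst : ∀ F : V → ℝ, (∀ v, F v ≤ B) → ∑ v, F v ≤ Fintype.card V * B := by
    intro F hF
    refine (Finset.sum_le_sum fun v _ => hF v).trans ?_
    simp
  -- The kernels are exchanged one at a time. With the third vertex fixed, the other two factors are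
  -- functions of one vertex each, so the rectangle bound applies.
  have e0 : ∑ u, ∑ v, ∑ w, (q 0 (u, v) - W 0 (u, v)) * (q 2 (u, w) * q 1 (v, w)) ≤
      Fintype.card V * B := by
    have : ∑ u, ∑ v, ∑ w, (q 0 (u, v) - W 0 (u, v)) * (q 2 (u, w) * q 1 (v, w)) =
        ∑ w, ∑ u, ∑ v, (q 0 (u, v) - W 0 (u, v)) * (q 2 (u, w) * q 1 (v, w)) := by
      rw [Finset.sum_comm]
      rw [Finset.sum_comm]
      simp_rw [Finset.sum_comm (s := (univ : Finset V)) (t := (univ : Finset V))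
        (f := fun v w => (q 0 (_, v) - W 0 (_, v)) * (q 2 (_, w) * q 1 (v, w)))]
      rw [Finset.sum_comm]
    rw [this]
    exact hconst _ fun w => sum_mul_mul_le_of_rectangles (fun a => q 0 a - W 0 a) (hB 0)
      (fun _ => hq0 _ _) (fun _ => hq1 _ _) (fun _ => hq0 _ _) (fun _ => hq1 _ _)
  have e1 : ∑ u, ∑ v, ∑ w, (q 1 (v, w) - W 1 (v, w)) * (W 0 (u, v) * q 2 (u, w)) ≤
      Fintype.card V * B :=
    hconst _ fun u => sum_mul_mul_le_of_rectangles (fun a => q 1 a - W 1 a) (hB 1)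
      (fun _ => hW0 _ _) (fun _ => hW1 _ _) (fun _ => hq0 _ _) (fun _ => hq1 _ _)
  have e2 : ∑ u, ∑ v, ∑ w, (q 2 (u, w) - W 2 (u, w)) * (W 0 (u, v) * W 1 (v, w)) ≤
      Fintype.card V * B := by
    rw [Finset.sum_comm]
    exact hconst _ fun v => sum_mul_mul_le_of_rectangles (fun a => q 2 a - W 2 a) (hB 2)
      (fun _ => hW0 _ _) (fun _ => hW1 _ _) (fun _ => hW0 _ _) (fun _ => hW1 _ _)
  have key : ∑ u, ∑ v, ∑ w, q 0 (u, v) * q 1 (v, w) * q 2 (u, w) =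
      ∑ u, ∑ v, ∑ w, W 0 (u, v) * W 1 (v, w) * W 2 (u, w) +
      (∑ u, ∑ v, ∑ w, (q 0 (u, v) - W 0 (u, v)) * (q 2 (u, w) * q 1 (v, w)) +
      ∑ u, ∑ v, ∑ w, (q 1 (v, w) - W 1 (v, w)) * (W 0 (u, v) * q 2 (u, w)) +
      ∑ u, ∑ v, ∑ w, (q 2 (u, w) - W 2 (u, w)) * (W 0 (u, v) * W 1 (v, w))) := by
    simp only [← Finset.sum_add_distrib]
    exact Finset.sum_congr rfl fun u _ => Finset.sum_congr rfl fun v _ =>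
      Finset.sum_congr rfl fun w _ => by ring
  rw [key]
  linarith

/-- The triangle inequality up to rounding, in all three orders. -/
def IsRoundedTriangle {N : ℕ} (a b c : Fin (N + 1)) : Prop :=
  (c : ℕ) ≤ a + b + 1 ∧ (a : ℕ) ≤ b + c + 1 ∧ (b : ℕ) ≤ a + c + 1

/-- Testing each maximum against the other two minima and adding gives ∑ max ≤ 2 ∑ min + 3, while
each size is at most max − min + 1 and each max is at most N. -/
theorem card_add_card_add_card_le {N : ℕ} {A B C : Finset (Fin (N + 1))} (hA : A.Nonempty)
    (hB : B.Nonempty) (hC : C.Nonempty)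
    (h : ∀ a ∈ A, ∀ b ∈ B, ∀ c ∈ C, IsRoundedTriangle a b c) :
    2 * (#A + #B + #C) ≤ 3 * N + 9 := by
  have hcard : ∀ X : Finset (Fin (N + 1)), ∀ hX : X.Nonempty,
      #X ≤ (X.max' hX : ℕ) + 1 - (X.min' hX : ℕ) := by
    intro X hX
    rw [← Fin.card_Icc]
    exact Finset.card_le_card fun x hx =>
      Finset.mem_Icc.2 ⟨Finset.min'_le _ _ hx, Finset.le_max' _ _ hx⟩
  have hle : ∀ X : Finset (Fin (N + 1)), ∀ hX : X.Nonempty,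
      (X.min' hX : ℕ) ≤ (X.max' hX : ℕ) := fun X hX => X.min'_le _ (X.max'_mem hX)
  have h1 := (h _ (A.min'_mem hA) _ (B.min'_mem hB) _ (C.max'_mem hC)).1
  have h2 := (h _ (A.max'_mem hA) _ (B.min'_mem hB) _ (C.min'_mem hC)).2.1
  have h3 := (h _ (A.min'_mem hA) _ (B.max'_mem hB) _ (C.min'_mem hC)).2.2
  have := hcard A hA
  have := hcard B hB
  have := hcard C hC
  have := hle A hA
  have := hle B hB
  have := hle C hC
  have := (A.max' hA).is_lt
  have := (B.max' hB).is_lt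
  have := (C.max' hC).is_lt
  omega

/-- A colouring of the pairs satisfying the rounded triangle inequality mostly follows a family of
palettes, given by a bounded partition, whose average size is about half of the colours. -/
theorem exists_palettes {N : ℕ} {ε η : ℝ} (hε : 0 < ε) (hη : 0 < η) (hηN : η * (N + 1) ≤ 1)
    {K : ℕ} (hK : 1 < K * ε ^ 2) (col : V → V → Fin (N + 1)) (hsymm : ∀ u v, col u v = col v u)
    (htri : ∀ u v w, (col u w : ℕ) ≤ col u v + col v w + 1) :
    ∃ (π : V → Fin (4 ^ K)) (P : Sym2 (Fin (4 ^ K)) → Finset (Fin (N + 1))),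
      ∑ u, ∑ v, (if col u v ∈ P s(π u, π v) then (0 : ℝ) else 1) ≤
        η * (N + 1) * (Fintype.card V : ℝ) ^ 2 ∧
      ∑ u, ∑ v, (#(P s(π u, π v)) : ℝ) ≤
        ((N + 3) / 2 + 3 * ε * (N + 1) ^ 4 / η ^ 3) * (Fintype.card V : ℝ) ^ 2 := by
  classical
  rcases isEmpty_or_nonempty V with hV | hV
  · exact ⟨fun v => isEmptyElim v, fun _ => ∅, by simp, by simp⟩
  set W : Fin (N + 1) → V × V → ℝ := fun c a => if col a.1 a.2 = c then 1 else 0 with hW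
  have hW0 : ∀ c a, 0 ≤ W c a := fun c a => by simp only [hW]; split_ifs <;> norm_num
  have hWsum : ∀ a, ∑ c, W c a = 1 := fun a => by simp [hW]
  have hW1 : ∀ c a, W c a ≤ 1 := fun c a => by simp only [hW]; split_ifs <;> norm_num
  obtain ⟨π, hπ, hreg⟩ := exists_isCutRegular hε hK hW0 hWsum
  set q : Fin (N + 1) → V × V → ℝ := fun c => fiberAverage (Prod.map π π) (W c) with hq
  have hq0 : ∀ c a, 0 ≤ q c a := fun c => fiberAverage_nonneg _ (hW0 c)
  have hqsum : ∀ a, ∑ c, q c a = 1 := sum_fiberAverage_eq_one _ hWsum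
  have hq1 : ∀ c a, q c a ≤ 1 := fun c a => by
    rw [← hqsum a]
    exact Finset.single_le_sum (f := fun c => q c a) (fun c _ => hq0 c a) (Finset.mem_univ c)
  have hqswap : ∀ c u v, q c (u, v) = q c (v, u) := fun c u v =>
    fiberAverage_swap π (fun a => by simp [hW, hsymm a.2 a.1]) (v, u)
  have hqcongr : ∀ c u v u' v', π u = π u' → π v = π v' → q c (u, v) = q c (u', v') :=
    fun c u v u' v' h1 h2 => fiberAverage_congr _ _ (by simp [h1, h2])
  set A : V → V → Finset (Fin (N + 1)) := fun u v => {c | η ≤ q c (u, v)} with hA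
  have hmemA : ∀ u v c, c ∈ A u v ↔ η ≤ q c (u, v) := fun u v c => by simp [hA]
  let π' : V → Fin (4 ^ K) := fun v => ⟨π v, hπ v⟩
  -- The densities are symmetric and depend only on cells, so palettes descend to unordered pairs of
  -- cells; unrealised pairs get the empty palette.
  obtain ⟨P, hP⟩ : ∃ P : Sym2 (Fin (4 ^ K)) → Finset (Fin (N + 1)),
      ∀ u v, P s(π' u, π' v) = A u v := by
    refine ⟨fun z => {c | ∃ u v, s(π' u, π' v) = z ∧ c ∈ A u v}, fun u v => ?_⟩
    ext c
    simp only [Finset.mem_filter, Finset.mem_univ, true_and]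
    refine ⟨?_, fun h => ⟨u, v, rfl, h⟩⟩
    rintro ⟨u', v', h, hc⟩
    rw [hmemA] at hc ⊢
    simp only [Sym2.eq_iff, π', Fin.mk.injEq] at h
    rcases h with h | h
    · rwa [← hqcongr c _ _ _ _ h.1 h.2]
    · rwa [hqswap, ← hqcongr c _ _ _ _ h.1 h.2]
  refine ⟨π', P, ?_, ?_⟩
  · simp only [hP]
    have h1 : ∀ u v, (if col u v ∈ A u v then (0 : ℝ) else 1) =
        ∑ c, W c (u, v) * (if c ∈ A u v then 0 else 1) := fun u v => by
      simp only [hW, ite_mul, one_mul, zero_mul, Finset.sum_ite_eq, Finset.mem_univ, if_true]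
    simp only [h1]
    rw [← Fintype.sum_prod_type' (f := fun u v => ∑ c, W c (u, v) * (if c ∈ A u v then 0 else 1)),
      Finset.sum_comm]
    have h2 : ∀ c, ∑ a : V × V, W c (a.1, a.2) * (if c ∈ A a.1 a.2 then (0 : ℝ) else 1) ≤
        η * (Fintype.card V : ℝ) ^ 2 := by
      intro c
      -- Lying outside the palette is constant on cells, so the indicator may be replaced by its
      -- density, which is below η there.
      have := sum_fiberAverage_mul (Prod.map π π) (W c)
        (f := fun a => if c ∈ A a.1 a.2 then (0 : ℝ) else 1) (by
          rintro ⟨u, v⟩ ⟨u', v'⟩ h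
          simp only [Prod.map_apply, Prod.mk.injEq] at h
          simp only [hmemA, hqcongr c u v u' v' h.1 h.2])
      simp only [Prod.mk.eta]
      rw [← this]
      calc _ ≤ ∑ a : V × V, η := by
            refine Finset.sum_le_sum fun a _ => ?_
            split_ifs with h
            · simpa using hη.le
            · rw [hmemA, not_le] at h
              simpa using h.le
        _ = η * (Fintype.card V : ℝ) ^ 2 := by simp; ring
    refine (Finset.sum_le_sum fun c _ => h2 c).trans (le_of_eq ?_)
    simp
    ring
  · simp only [hP]
    -- The N+1 densities sum to 1, so η(N+1) ≤ 1 prevents all of them from being below η.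
    have hAne : ∀ u v, (A u v).Nonempty := by
      intro u v
      by_contra h
      rw [Finset.not_nonempty_iff_eq_empty] at h
      have h1 : ∀ c, q c (u, v) < η := fun c => by
        rw [← not_le, ← hmemA, h]
        simp
      have h2 : ∑ c, q c (u, v) < ∑ c : Fin (N + 1), η :=
        Finset.sum_lt_sum_of_nonempty Finset.univ_nonempty fun c _ => h1 c
      rw [hqsum] at h2
      simp only [Finset.sum_const, Finset.card_univ, Fintype.card_fin, nsmul_eq_mul] at h2
      push_cast at h2
      linarith
    set bad : V → V → V → ℝ := fun u v w => ∑ a, ∑ b, ∑ c,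
      if IsRoundedTriangle a b c then 0 else q a (u, v) * q b (v, w) * q c (u, w) with hbad
    have hterm0 : ∀ u v w a b c, 0 ≤ if IsRoundedTriangle a b c then 0 else
        q a (u, v) * q b (v, w) * q c (u, w) := fun u v w a b c => by
      split_ifs
      · exact le_rfl
      · exact mul_nonneg (mul_nonneg (hq0 _ _) (hq0 _ _)) (hq0 _ _)
    have hbad0 : ∀ u v w, 0 ≤ bad u v w := fun u v w =>
      Finset.sum_nonneg fun a _ => Finset.sum_nonneg fun b _ => Finset.sum_nonneg fun c _ =>
        hterm0 u v w a b c
    -- One forbidden palette triple makes `bad` at least η³, so the second term then covers the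
    -- trivial bound 3(N+1).
    have hpt : ∀ u v w, (#(A u v) : ℝ) + #(A v w) + #(A u w) ≤
        (3 * N + 9) / 2 + 3 * (N + 1) / η ^ 3 * bad u v w := by
      intro u v w
      by_cases hgood : ∀ a ∈ A u v, ∀ b ∈ A v w, ∀ c ∈ A u w, IsRoundedTriangle a b c
      · have h1 := card_add_card_add_card_le (hAne u v) (hAne v w) (hAne u w) hgood
        have h2 : (2 : ℝ) * (#(A u v) + #(A v w) + #(A u w)) ≤ 3 * N + 9 := by exact_mod_cast h1
        have h3 : 0 ≤ 3 * (N + 1) / η ^ 3 * bad u v w :=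
          mul_nonneg (by positivity) (hbad0 u v w)
        linarith
      · push Not at hgood
        obtain ⟨a, ha, b, hb, c, hc, h⟩ := hgood
        rw [hmemA] at ha hb hc
        have h1 : η ^ 3 ≤ bad u v w := by
          calc η ^ 3 = η * η * η := by ring
            _ ≤ q a (u, v) * q b (v, w) * q c (u, w) := by
              have := hq0 a (u, v)
              have := hq0 b (v, w)
              gcongr
            _ = if IsRoundedTriangle a b c then 0 else
                q a (u, v) * q b (v, w) * q c (u, w) := by rw [if_neg h]
            _ ≤ ∑ c, if IsRoundedTriangle a b c then 0 else
                q a (u, v) * q b (v, w) * q c (u, w) :=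
              Finset.single_le_sum (f := fun c => if IsRoundedTriangle a b c then 0 else
                q a (u, v) * q b (v, w) * q c (u, w)) (fun c _ => hterm0 u v w a b c)
                (Finset.mem_univ c)
            _ ≤ ∑ b, ∑ c, if IsRoundedTriangle a b c then 0 else
                q a (u, v) * q b (v, w) * q c (u, w) :=
              Finset.single_le_sum (f := fun b => ∑ c, if IsRoundedTriangle a b c then 0 else
                q a (u, v) * q b (v, w) * q c (u, w))
                (fun b _ => Finset.sum_nonneg fun c _ => hterm0 u v w a b c)
                (Finset.mem_univ b)
            _ ≤ bad u v w :=
              Finset.single_le_sum (f := fun a => ∑ b, ∑ c, if IsRoundedTriangle a b c then 0 else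
                q a (u, v) * q b (v, w) * q c (u, w))
                (fun a _ => Finset.sum_nonneg fun b _ => Finset.sum_nonneg fun c _ =>
                  hterm0 u v w a b c) (Finset.mem_univ a)
        have h2 : ∀ x y, (#(A x y) : ℝ) ≤ N + 1 := fun x y => by
          have := Finset.card_le_univ (A x y)
          rw [Fintype.card_fin] at this
          exact_mod_cast this
        have h3 : 3 * ((N : ℝ) + 1) ≤ 3 * (N + 1) / η ^ 3 * bad u v w := by
          rw [div_mul_eq_mul_div, le_div_iff₀ (by positivity)]
          gcongr
        have := h2 u v
        have := h2 v w
        have := h2 u w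
        have : (0 : ℝ) ≤ (3 * N + 9) / 2 := by positivity
        linarith
    have hbadsum : ∑ u, ∑ v, ∑ w, bad u v w ≤
        (N + 1) ^ 3 * (3 * (Fintype.card V * (ε * (Fintype.card V : ℝ) ^ 2))) := by
      have h1 : ∀ a b c, (∑ u, ∑ v, ∑ w, if IsRoundedTriangle a b c then 0 else
          q a (u, v) * q b (v, w) * q c (u, w)) ≤
          3 * (Fintype.card V * (ε * (Fintype.card V : ℝ) ^ 2)) := by
        intro a b c
        split_ifs with h
        · simp only [Finset.sum_const_zero]
          positivity
        · have h2 := sum_triangle_le (W := fun i => W (![a, b, c] i)) (q := fun i => q (![a, b, c] i))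
            (B := ε * (Fintype.card V : ℝ) ^ 2) (fun _ => hW0 _) (fun _ => hW1 _)
            (fun _ => hq0 _) (fun _ => hq1 _) (fun i S T => by
              refine le_trans (le_of_eq ?_) ((neg_le_abs _).trans (hreg (![a, b, c] i) S T))
              rw [← Finset.sum_neg_distrib]
              exact Finset.sum_congr rfl fun x _ => by simp only [hq]; ring)
          refine h2.trans (le_of_eq ?_)
          -- The main term vanishes: the colouring itself has no triangle with forbidden colours.
          rw [add_eq_right]
          refine Finset.sum_eq_zero fun u _ => Finset.sum_eq_zero fun v _ =>
            Finset.sum_eq_zero fun w _ => ?_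
          by_contra h3
          simp only [hW, Matrix.cons_val_zero, Matrix.cons_val_one, Matrix.cons_val] at h3
          have ha : col u v = a := by by_contra h4; simp [h4] at h3
          have hb : col v w = b := by by_contra h4; simp [h4] at h3
          have hc : col u w = c := by by_contra h4; simp [h4] at h3
          refine h ?_
          rw [← ha, ← hb, ← hc]
          refine ⟨htri u v w, ?_, ?_⟩
          · have := htri u w v
            rw [hsymm w v] at this
            omega
          · have := htri v u w
            rw [hsymm v u] at this
            omega
      have h2 : ∑ u, ∑ v, ∑ w, bad u v w = ∑ a, ∑ b, ∑ c, ∑ u, ∑ v, ∑ w,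
          if IsRoundedTriangle a b c then 0 else q a (u, v) * q b (v, w) * q c (u, w) := by
        have e1 : ∀ f : V × V × V → Fin (N + 1) × Fin (N + 1) × Fin (N + 1) → ℝ,
            ∑ u, ∑ v, ∑ w, ∑ a, ∑ b, ∑ c, f (u, v, w) (a, b, c) =
            ∑ a, ∑ b, ∑ c, ∑ u, ∑ v, ∑ w, f (u, v, w) (a, b, c) := by
          intro f
          have := Finset.sum_comm (s := univ) (t := univ) (f := f)
          simpa only [Fintype.sum_prod_type] using this
        exact e1 fun x y => if IsRoundedTriangle y.1 y.2.1 y.2.2 then 0 else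
          q y.1 (x.1, x.2.1) * q y.2.1 (x.2.1, x.2.2) * q y.2.2 (x.1, x.2.2)
      rw [h2]
      refine (Finset.sum_le_sum fun a _ => Finset.sum_le_sum fun b _ => Finset.sum_le_sum
        fun c _ => h1 a b c).trans (le_of_eq ?_)
      simp only [Finset.sum_const, Finset.card_univ, Fintype.card_fin, nsmul_eq_mul]
      push_cast
      ring
    have hsum := Finset.sum_le_sum fun u (_ : u ∈ (univ : Finset V)) =>
      Finset.sum_le_sum fun v (_ : v ∈ (univ : Finset V)) =>
        Finset.sum_le_sum fun w (_ : w ∈ (univ : Finset V)) => hpt u v w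
    have e2 : ∑ u, ∑ v, ∑ w, ((#(A u v) : ℝ) + #(A v w) + #(A u w)) =
        3 * Fintype.card V * ∑ u, ∑ v, (#(A u v) : ℝ) := by
      simp only [Finset.sum_add_distrib, Finset.sum_const, Finset.card_univ, nsmul_eq_mul,
        ← Finset.mul_sum]
      ring
    have e3 : ∑ u : V, ∑ v : V, ∑ w : V, ((3 * N + 9) / 2 + 3 * (N + 1) / η ^ 3 * bad u v w) =
        (3 * N + 9) / 2 * (Fintype.card V : ℝ) ^ 3 +
          3 * (N + 1) / η ^ 3 * ∑ u, ∑ v, ∑ w, bad u v w := by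
      simp only [Finset.sum_add_distrib, Finset.sum_const, Finset.card_univ, nsmul_eq_mul,
        ← Finset.mul_sum]
      ring
    rw [e2, e3] at hsum
    have hn : (0 : ℝ) < Fintype.card V := by exact_mod_cast Fintype.card_pos
    have hc : 0 ≤ 3 * ((N : ℝ) + 1) / η ^ 3 := by positivity
    have h5 := hsum.trans (add_le_add_right (mul_le_mul_of_nonneg_left hbadsum hc) _)
    refine le_of_mul_le_mul_left (h5.trans (le_of_eq ?_)) (show 0 < 3 * (Fintype.card V : ℝ) by
      positivity)
    field_simp
    ring

end Counting

/-! ### From palettes to a volume bound -/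

section Volume

open Finset

/-- The volume of the set of points of the unit cube with few coordinates outside given sets. -/
theorem volume_few_outside_le {ι : Type*} [Fintype ι] (B : ι → Set ℝ) {b : ι → ℝ}
    (hb : ∀ e, 0 ≤ b e) (hB : ∀ e, volume (B e) ≤ ENNReal.ofReal (b e)) {L : ℝ} (hL : 0 ≤ L)
    (m : ℝ) :
    volume {d : ι → ℝ | (∀ e, d e ∈ Set.Icc (0 : ℝ) 1) ∧ ∃ F : Finset ι,
      (#F : ℝ) ≤ m ∧ ∀ e ∉ F, d e ∈ B e} ≤
      ENNReal.ofReal (Real.exp (L * m) * ∏ e, (Real.exp (-L) + b e)) := by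
  classical
  have hsub : {d : ι → ℝ | (∀ e, d e ∈ Set.Icc (0 : ℝ) 1) ∧ ∃ F : Finset ι,
      (#F : ℝ) ≤ m ∧ ∀ e ∉ F, d e ∈ B e} ⊆
      ⋃ F ∈ (univ.filter fun F : Finset ι => (#F : ℝ) ≤ m),
        Set.pi Set.univ fun e => if e ∈ F then Set.Icc (0 : ℝ) 1 else B e := by
    rintro d ⟨h01, F, hF, hd⟩
    simp only [Set.mem_iUnion]
    refine ⟨F, by simpa using hF, fun e _ => ?_⟩
    by_cases he : e ∈ F
    · simpa [he] using h01 e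
    · simpa [he] using hd e he
  have hbox : ∀ F : Finset ι,
      volume (Set.pi Set.univ fun e => if e ∈ F then Set.Icc (0 : ℝ) 1 else B e) ≤
        ENNReal.ofReal (∏ e, if e ∈ F then 1 else b e) := by
    intro F
    rw [volume_pi_pi, ENNReal.ofReal_prod_of_nonneg fun e _ => by
      split_ifs
      · exact zero_le_one
      · exact hb e]
    refine Finset.prod_le_prod' fun e _ => ?_
    split_ifs
    · simp
    · exact hB e
  have hprod : ∀ F : Finset ι, 0 ≤ ∏ e, if e ∈ F then 1 else b e := fun F =>
    Finset.prod_nonneg fun e _ => by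
      split_ifs
      · exact zero_le_one
      · exact hb e
  refine (measure_mono hsub).trans ((measure_biUnion_finset_le _ _).trans ?_)
  refine (Finset.sum_le_sum fun F _ => hbox F).trans ?_
  rw [← ENNReal.ofReal_sum_of_nonneg fun F _ => hprod F]
  refine ENNReal.ofReal_le_ofReal ?_
  -- Exponential weighting: expanding the product gives a sum over all exceptional sets, in which
  -- each set of size at most m carries weight exp(L(m − #F)) ≥ 1.
  rw [Finset.prod_add, Finset.mul_sum]
  have hpow : ∀ F : Finset ι, Real.exp (L * m) *
      ((∏ _e ∈ F, Real.exp (-L)) * ∏ e ∈ univ \ F, b e) =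
      Real.exp (L * (m - #F)) * ∏ e, if e ∈ F then 1 else b e := by
    intro F
    rw [Finset.prod_const, ← Real.exp_nat_mul, ← mul_assoc, ← Real.exp_add, Finset.prod_ite,
      Finset.prod_const_one, one_mul]
    congr 1
    · congr 1
      ring
    · refine Finset.prod_congr ?_ fun _ _ => rfl
      ext e
      simp
  simp only [hpow, Finset.powerset_univ]
  refine (Finset.sum_le_sum fun F hF => ?_).trans (Finset.sum_le_sum_of_subset_of_nonneg
    (Finset.filter_subset _ _) fun F _ _ => mul_nonneg (Real.exp_pos _).le (hprod F))
  have hF' : (#F : ℝ) ≤ m := by simpa using hF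
  exact le_mul_of_one_le_left (hprod F)
    (Real.one_le_exp (mul_nonneg hL (sub_nonneg.2 hF')))

/-- Every edge comes from two ordered pairs; the diagonal is only discarded. -/
theorem two_mul_sum_completeEdge_le {n : ℕ} {F : Sym2 (Fin n) → ℝ} (hF : ∀ z, 0 ≤ F z) :
    2 * ∑ e : CompleteEdge n, F e.1 ≤ ∑ u, ∑ v, F s(u, v) := by
  classical
  have h1 : ∑ u, ∑ v, F s(u, v) =
      ∑ z : Sym2 (Fin n), (#{a : Fin n × Fin n | s(a.1, a.2) = z} : ℝ) * F z := by
    rw [← Fintype.sum_prod_type' (f := fun u v => F s(u, v)),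
      ← Finset.sum_fiberwise (s := univ) (g := fun a : Fin n × Fin n => s(a.1, a.2))]
    refine Finset.sum_congr rfl fun z _ => ?_
    rw [← nsmul_eq_mul, ← Finset.sum_const]
    refine Finset.sum_congr rfl fun a ha => ?_
    rw [(Finset.mem_filter.1 ha).2]
  rw [h1, Finset.mul_sum]
  have h2 : ∀ e : CompleteEdge n, 2 * F e.1 ≤
      (#{a : Fin n × Fin n | s(a.1, a.2) = e.1} : ℝ) * F e.1 := by
    rintro ⟨z, hz⟩
    refine mul_le_mul_of_nonneg_right ?_ (hF z)
    induction z using Sym2.ind with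
    | _ x y =>
      have hxy : x ≠ y := by simpa using hz
      have h3 : ({(x, y), (y, x)} : Finset (Fin n × Fin n)) ⊆
          univ.filter fun a : Fin n × Fin n => s(a.1, a.2) = s(x, y) := by
        intro a ha
        simp only [Finset.mem_insert, Finset.mem_singleton] at ha
        rcases ha with rfl | rfl
        · simp
        · simp
      have h4 := Finset.card_le_card h3
      rw [Finset.card_pair (by simp [hxy])] at h4
      exact_mod_cast h4
  refine (Finset.sum_le_sum fun e _ => h2 e).trans ?_
  refine le_trans (le_of_eq (Finset.sum_map univ (Function.Embedding.subtype _)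
    (fun z => (#{a : Fin n × Fin n | s(a.1, a.2) = z} : ℝ) * F z)).symm) ?_
  exact Finset.sum_le_sum_of_subset_of_nonneg (Finset.subset_univ _)
    fun z _ _ => mul_nonneg (Nat.cast_nonneg _) (hF z)

theorem card_completeEdge (n : ℕ) : Fintype.card (CompleteEdge n) = n.choose 2 := by
  classical
  have h := SimpleGraph.card_edgeFinset_top_eq_card_choose_two (V := Fin n)
  rw [Fintype.card_fin] at h
  rw [← h, ← Set.toFinset_card]
  congr!

/-- The distance matrix of a weighting of the edges. -/
noncomputable def edgeDist {n : ℕ} (d : CompleteEdge n → ℝ) (u v : Fin n) : ℝ :=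
  if h : u ≠ v then d (completeEdge u v h) else 0

theorem edgeDist_comm {n : ℕ} (d : CompleteEdge n → ℝ) (u v : Fin n) :
    edgeDist d u v = edgeDist d v u := by
  by_cases h : u = v
  · simp [h]
  · simp [edgeDist, h, Ne.symm h, completeEdge, Sym2.eq_swap]

theorem edgeDist_mem_Icc {n : ℕ} {d : CompleteEdge n → ℝ} (hd : d ∈ metricPolytope n)
    (u v : Fin n) : edgeDist d u v ∈ Set.Icc (0 : ℝ) 1 := by
  unfold edgeDist
  split_ifs
  · exact hd.1 _
  · simp

theorem edgeDist_triangle {n : ℕ} {d : CompleteEdge n → ℝ} (hd : d ∈ metricPolytope n)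
    (u v w : Fin n) : edgeDist d u w ≤ edgeDist d u v + edgeDist d v w := by
  by_cases huv : u = v
  · subst huv
    simp [edgeDist]
  by_cases hvw : v = w
  · subst hvw
    simp [edgeDist]
  by_cases huw : u = w
  · subst huw
    have h1 := (edgeDist_mem_Icc hd u v).1
    have h2 := (edgeDist_mem_Icc hd v u).1
    simp only [edgeDist, ne_eq, not_true_eq_false, dite_false] at h1 h2 ⊢
    linarith
  simpa [edgeDist, huv, hvw, huw] using hd.2 u v w huv hvw huw

/-- The points of `[0, 1]` whose colour, i.e. whose rounding to a multiple of `1 / N`, is in the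
palette `A`. -/
def paletteSet (N : ℕ) (A : Finset (Fin (N + 1))) : Set ℝ :=
  {x | 0 ≤ x ∧ ∃ c ∈ A, ⌊N * x⌋₊ = (c : ℕ)}

theorem volume_paletteSet_le {N : ℕ} (hN : 0 < N) (A : Finset (Fin (N + 1))) :
    volume (paletteSet N A) ≤ ENNReal.ofReal ((#A : ℝ) / N) := by
  have hN' : (0 : ℝ) < N := by exact_mod_cast hN
  have hsub : paletteSet N A ⊆
      ⋃ c ∈ A, Set.Icc (((c : ℕ) : ℝ) / N) ((((c : ℕ) : ℝ) + 1) / N) := by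
    rintro x ⟨hx, c, hc, hxc⟩
    simp only [Set.mem_iUnion]
    refine ⟨c, hc, ?_, ?_⟩
    · rw [div_le_iff₀ hN', ← hxc, mul_comm x]
      exact Nat.floor_le (by positivity)
    · rw [le_div_iff₀ hN', ← hxc, mul_comm x]
      exact (Nat.lt_floor_add_one _).le
  refine (measure_mono hsub).trans ((measure_biUnion_finset_le _ _).trans ?_)
  have h1 : ∀ c : Fin (N + 1),
      volume (Set.Icc (((c : ℕ) : ℝ) / N) ((((c : ℕ) : ℝ) + 1) / N)) = ENNReal.ofReal (1 / N) := by
    intro c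
    rw [Real.volume_Icc]
    congr 1
    ring
  simp only [h1, Finset.sum_const, nsmul_eq_mul]
  rw [div_eq_mul_one_div (#A : ℝ), ENNReal.ofReal_mul (Nat.cast_nonneg _), ENNReal.ofReal_natCast]

/-- A substitute for AM–GM: x ≤ exp(2x − 1)/2, with equality at x = 1/2. -/
theorem prod_le_half_pow_mul_exp {ι : Type*} [Fintype ι] {x : ι → ℝ} (hx : ∀ e, 0 ≤ x e) :
    ∏ e, x e ≤ (1 / 2) ^ Fintype.card ι * Real.exp (2 * ∑ e, x e - Fintype.card ι) := by
  have h1 : ∀ e, x e ≤ 1 / 2 * Real.exp (2 * x e - 1) := fun e => by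
    have := Real.add_one_le_exp (2 * x e - 1)
    linarith
  refine (Finset.prod_le_prod (fun e _ => hx e) fun e _ => h1 e).trans (le_of_eq ?_)
  rw [Finset.prod_mul_distrib, ← Real.exp_sum, Finset.prod_const, Finset.card_univ,
    Finset.sum_sub_distrib, ← Finset.mul_sum]
  simp

theorem volume_metricPolytope_le {N : ℕ} (hN : 0 < N) {ε η L : ℝ} (hε : 0 < ε) (hη : 0 < η)
    (hηN : η * (N + 1) ≤ 1) (hL : 0 ≤ L) {K : ℕ} (hK : 1 < K * ε ^ 2) (n : ℕ) :
    volume (metricPolytope n) ≤ ENNReal.ofReal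
      (((4 ^ K) ^ n * (2 ^ (N + 1)) ^ Fintype.card (Sym2 (Fin (4 ^ K)))) *
        (Real.exp (L * (η * (N + 1) * (n : ℝ) ^ 2 / 2)) * ((1 / 2) ^ n.choose 2 *
          Real.exp (((N + 3) / 2 + 3 * ε * (N + 1) ^ 4 / η ^ 3) * (n : ℝ) ^ 2 / N +
            Real.exp (-L) * (n : ℝ) ^ 2 - n.choose 2)))) := by
  classical
  have hN' : (0 : ℝ) < N := by exact_mod_cast hN
  set Γ : ℝ := (N + 3) / 2 + 3 * ε * (N + 1) ^ 4 / η ^ 3 with hΓ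
  set m : ℝ := η * (N + 1) * (n : ℝ) ^ 2 / 2 with hm
  let I := (Fin n → Fin (4 ^ K)) × (Sym2 (Fin (4 ^ K)) → Finset (Fin (N + 1)))
  let A : I → CompleteEdge n → Finset (Fin (N + 1)) := fun i e => i.2 (e.1.map i.1)
  let J : Finset I := {i | 2 * ∑ e, (#(A i e) : ℝ) ≤ Γ * (n : ℝ) ^ 2}
  let S : I → Set (CompleteEdge n → ℝ) := fun i =>
    {d | (∀ e, d e ∈ Set.Icc (0 : ℝ) 1) ∧ ∃ F : Finset (CompleteEdge n),
      (#F : ℝ) ≤ m ∧ ∀ e ∉ F, d e ∈ paletteSet N (A i e)}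
  have hsub : metricPolytope n ⊆ ⋃ i ∈ J, S i := by
    intro d hd
    have hD := edgeDist_mem_Icc hd
    have hfl : ∀ u v, ⌊N * edgeDist d u v⌋₊ < N + 1 := fun u v => by
      rw [Nat.lt_succ_iff]
      refine Nat.floor_le_of_le ?_
      exact mul_le_of_le_one_right hN'.le (hD u v).2
    obtain ⟨π, P, h1, h2⟩ := exists_palettes hε hη hηN hK
      (fun u v => (⟨⌊N * edgeDist d u v⌋₊, hfl u v⟩ : Fin (N + 1)))
      (fun u v => by simp only [edgeDist_comm d u v])
      -- The two floors on the right lose less than 2 in total, so between integers the slack is 1.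
      (fun u v w => by
        have e1 := Nat.lt_floor_add_one (N * edgeDist d u v)
        have e2 := Nat.lt_floor_add_one (N * edgeDist d v w)
        have e3 := Nat.floor_le (mul_nonneg hN'.le (hD u w).1)
        have e4 := mul_le_mul_of_nonneg_left (edgeDist_triangle hd u v w) hN'.le
        have e5 : (⌊N * edgeDist d u w⌋₊ : ℝ) <
            ((⌊N * edgeDist d u v⌋₊ + ⌊N * edgeDist d v w⌋₊ + 2 : ℕ) : ℝ) := by
          push_cast
          linarith
        have e6 : ⌊N * edgeDist d u w⌋₊ < _ := Nat.cast_lt.1 e5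
        simp only
        omega)
    rw [Fintype.card_fin] at h1 h2
    simp only [Set.mem_iUnion]
    refine ⟨(π, P), ?_, hd.1, univ.filter fun e => d e ∉ paletteSet N (A (π, P) e), ?_, ?_⟩
    · simp only [J, Finset.mem_filter, Finset.mem_univ, true_and]
      exact (two_mul_sum_completeEdge_le (F := fun z => (#(P (z.map π)) : ℝ))
        fun z => Nat.cast_nonneg _).trans h2
    · let G : Sym2 (Fin n) → ℝ := fun z =>
        if h : z ∈ (⊤ : SimpleGraph (Fin n)).edgeSet then
          (if d ⟨z, h⟩ ∈ paletteSet N (P (z.map π)) then 0 else 1) else 0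
      have hG0 : ∀ z, 0 ≤ G z := fun z => by
        simp only [G]
        split_ifs <;> norm_num
      have e1 := two_mul_sum_completeEdge_le hG0
      have e2 : ∑ e : CompleteEdge n, G e.1 =
          (#{e | d e ∉ paletteSet N (A (π, P) e)} : ℝ) := by
        rw [Finset.card_filter, Nat.cast_sum]
        refine Finset.sum_congr rfl fun e _ => ?_
        simp only [G, A, dif_pos e.2]
        by_cases h : d e ∈ paletteSet N (P (e.1.map π)) <;> simp [h]
      have e3 : ∑ u, ∑ v, G s(u, v) ≤ η * (N + 1) * (n : ℝ) ^ 2 := by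
        refine le_trans (Finset.sum_le_sum fun u _ => Finset.sum_le_sum fun v _ => ?_) h1
        by_cases h : u = v
        · simp only [h, G, SimpleGraph.mem_edgeSet, SimpleGraph.irrefl, dite_false]
          split_ifs <;> norm_num
        · have hin : s(u, v) ∈ (⊤ : SimpleGraph (Fin n)).edgeSet := by simpa using h
          simp only [G, hin, dite_true]
          have hde : edgeDist d u v = d ⟨s(u, v), hin⟩ := by
            simp [edgeDist, h, completeEdge]
          by_cases hc : (⟨⌊N * edgeDist d u v⌋₊, hfl u v⟩ : Fin (N + 1)) ∈ P s(π u, π v)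
          · rw [if_pos hc, if_pos]
            rw [← hde]
            exact ⟨(hD u v).1, _, hc, rfl⟩
          · rw [if_neg hc]
            split_ifs <;> norm_num
      rw [e2] at e1
      rw [hm]
      linarith
    · intro e he
      simpa using he
  have hS : ∀ i ∈ J, volume (S i) ≤ ENNReal.ofReal
      (Real.exp (L * m) * ((1 / 2) ^ n.choose 2 * Real.exp (Γ * (n : ℝ) ^ 2 / N +
        Real.exp (-L) * (n : ℝ) ^ 2 - n.choose 2))) := by
    intro i hi
    refine (volume_few_outside_le (fun e => paletteSet N (A i e))
      (b := fun e => (#(A i e) : ℝ) / N) (fun e => by positivity)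
      (fun e => volume_paletteSet_le hN _) hL m).trans (ENNReal.ofReal_le_ofReal ?_)
    refine mul_le_mul_of_nonneg_left ?_ (Real.exp_pos _).le
    refine (prod_le_half_pow_mul_exp fun e => by positivity).trans ?_
    rw [card_completeEdge]
    refine mul_le_mul_of_nonneg_left (Real.exp_le_exp.2 (sub_le_sub_right ?_ _)) (by positivity)
    simp only [J, Finset.mem_filter, Finset.mem_univ, true_and] at hi
    rw [Finset.sum_add_distrib, ← Finset.sum_div, Finset.sum_const, Finset.card_univ,
      card_completeEdge, nsmul_eq_mul]
    have h1 : 2 * ((∑ e, (#(A i e) : ℝ)) / N) ≤ Γ * (n : ℝ) ^ 2 / N := by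
      rw [← mul_div_assoc]
      gcongr
    have h2 : 2 * (n.choose 2 : ℝ) ≤ (n : ℝ) ^ 2 := by
      rw [Nat.cast_choose_two]
      nlinarith [(Nat.cast_nonneg n : (0 : ℝ) ≤ n)]
    have h3 := mul_le_mul_of_nonneg_right h2 (Real.exp_pos (-L)).le
    linarith
  refine (measure_mono hsub).trans ((measure_biUnion_finset_le _ _).trans ?_)
  refine (Finset.sum_le_sum hS).trans ?_
  rw [Finset.sum_const, nsmul_eq_mul, ← ENNReal.ofReal_natCast,
    ← ENNReal.ofReal_mul (Nat.cast_nonneg _)]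
  refine ENNReal.ofReal_le_ofReal (mul_le_mul_of_nonneg_right ?_ (by positivity))
  -- The union bound counts all pairs (partition, palettes); for fixed `K` and `N` the logarithm of
  -- the count is linear in n.
  have hcard : #J ≤ Fintype.card I := Finset.card_le_univ _
  have hI : Fintype.card I =
      (4 ^ K) ^ n * (2 ^ (N + 1)) ^ Fintype.card (Sym2 (Fin (4 ^ K))) := by
    simp [I, Fintype.card_prod]
  rw [hI] at hcard
  exact_mod_cast hcard

end Volume

/-! ### Matching bounds and the asymptotics -/

theorem half_pow_le_volume_metricPolytope (n : ℕ) :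
    ENNReal.ofReal ((1 / 2) ^ n.choose 2) ≤ volume (metricPolytope n) := by
  have hsub : Set.pi Set.univ (fun _ : CompleteEdge n => Set.Icc (1 / 2 : ℝ) 1) ⊆
      metricPolytope n := by
    intro d hd
    have h : ∀ e, 1 / 2 ≤ d e ∧ d e ≤ 1 := fun e => hd e trivial
    refine ⟨fun e => ⟨by linarith [(h e).1], (h e).2⟩, fun i j k hij hjk hik => ?_⟩
    linarith [(h (completeEdge i k hik)).2, (h (completeEdge i j hij)).1,
      (h (completeEdge j k hjk)).1]
  refine le_trans (le_of_eq ?_) (measure_mono hsub)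
  rw [volume_pi_pi]
  simp only [Real.volume_Icc, Finset.prod_const, Finset.card_univ, card_completeEdge]
  rw [← ENNReal.ofReal_pow (by norm_num)]
  norm_num

theorem volume_metricPolytope_le_eventually {δ : ℝ} (hδ : 0 < δ) :
    ∃ n₀ : ℕ, ∀ n ≥ n₀, volume (metricPolytope n) ≤
      ENNReal.ofReal ((1 / 2) ^ n.choose 2 * Real.exp (δ * (n : ℝ) ^ 2)) := by
  -- Order of choice: `L` and `N` from δ, then η, then ε, then `K`, then n₀. The errors in the
  -- exponent are each at most δ/6 or δ/3 times n² and add up to δn².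
  obtain ⟨L, hL, hLδ⟩ : ∃ L : ℝ, 0 ≤ L ∧ Real.exp (-L) ≤ δ / 6 := by
    refine ⟨max 0 (-Real.log (δ / 6)), le_max_left _ _, ?_⟩
    rw [← Real.le_log_iff_exp_le (by positivity)]
    linarith [le_max_right 0 (-Real.log (δ / 6))]
  obtain ⟨N, hN⟩ := exists_nat_gt (max 1 (9 / δ))
  have hN1 : (1 : ℝ) < N := (le_max_left _ _).trans_lt hN
  have hNδ : 9 / δ < N := (le_max_right _ _).trans_lt hN
  have hN0 : 0 < N := by exact_mod_cast zero_lt_one.trans hN1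
  have hNpos : (0 : ℝ) < N := by linarith
  obtain ⟨η, hη, hηN, hηδ⟩ : ∃ η : ℝ, 0 < η ∧ η * (N + 1) ≤ 1 ∧ L * (η * (N + 1)) ≤ δ / 6 := by
    set t : ℝ := min 1 (δ / (6 * (L + 1))) with ht
    have htpos : 0 < t := lt_min one_pos (by positivity)
    have hcancel : t / (N + 1) * (N + 1) = t := div_mul_cancel₀ _ (by positivity)
    refine ⟨t / (N + 1), by positivity, ?_, ?_⟩
    · rw [hcancel]
      exact min_le_left _ _
    · rw [hcancel]
      have h1 : t ≤ δ / (6 * (L + 1)) := min_le_right _ _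
      rw [le_div_iff₀ (by positivity)] at h1
      nlinarith
  obtain ⟨ε, hε, hεδ⟩ : ∃ ε : ℝ, 0 < ε ∧ 3 * ε * (N + 1) ^ 4 / η ^ 3 = δ / 6 := by
    refine ⟨δ / 6 * η ^ 3 / (3 * (N + 1) ^ 4), by positivity, ?_⟩
    field_simp
  obtain ⟨K, hK⟩ : ∃ K : ℕ, 1 < K * ε ^ 2 := by
    obtain ⟨K, hK⟩ := exists_nat_gt (1 / ε ^ 2)
    exact ⟨K, by rwa [div_lt_iff₀ (by positivity)] at hK⟩
  -- The summand 1/2 absorbs the n/2 in −n(n−1)/2 = −n²/2 + n/2.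
  set a : ℝ := K * Real.log 4 + 1 / 2 with ha
  set b : ℝ := Fintype.card (Sym2 (Fin (4 ^ K))) * ((N + 1) * Real.log 2) with hb
  have hb0 : 0 ≤ b := by positivity
  obtain ⟨n₀, hn₀⟩ := exists_nat_gt (max 1 (3 * (a + b) / δ))
  refine ⟨n₀, fun n hn => ?_⟩
  have hn' : (n₀ : ℝ) ≤ n := by exact_mod_cast hn
  have hn1 : 1 < (n : ℝ) := ((le_max_left _ _).trans_lt hn₀).trans_le hn'
  have hnab : 3 * (a + b) / δ < n := ((le_max_right _ _).trans_lt hn₀).trans_le hn'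
  have hlin : a * n + b ≤ δ / 3 * (n : ℝ) ^ 2 := by
    rw [div_lt_iff₀ hδ] at hnab
    nlinarith
  refine (volume_metricPolytope_le hN0 hε hη hηN hL hK n).trans (ENNReal.ofReal_le_ofReal ?_)
  have e1 : ((4 : ℝ) ^ K) ^ n = Real.exp (n * (K * Real.log 4)) := by
    rw [Real.exp_nat_mul, Real.exp_nat_mul, Real.exp_log (by norm_num)]
  have e2 : ((2 : ℝ) ^ (N + 1)) ^ Fintype.card (Sym2 (Fin (4 ^ K))) = Real.exp b := by
    have : ((N : ℝ) + 1) = ((N + 1 : ℕ) : ℝ) := by push_cast; rfl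
    rw [hb, this, Real.exp_nat_mul, Real.exp_nat_mul, Real.exp_log (by norm_num)]
  rw [e1, e2, mul_left_comm (Real.exp (L * _)), mul_left_comm _ ((1 / 2 : ℝ) ^ _),
    ← Real.exp_add, ← Real.exp_add, ← Real.exp_add, hεδ]
  refine mul_le_mul_of_nonneg_left (Real.exp_le_exp.2 ?_) (by positivity)
  rw [Nat.cast_choose_two]
  have h1 : ((N + 3) / 2 + δ / 6) * (n : ℝ) ^ 2 / N ≤ (1 / 2 + δ / 6 + δ / 6) * (n : ℝ) ^ 2 := by
    rw [div_le_iff₀ hNpos, mul_right_comm]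
    refine mul_le_mul_of_nonneg_right ?_ (by positivity)
    rw [div_lt_iff₀ hδ] at hNδ
    nlinarith
  have h2 : L * (η * (N + 1) * (n : ℝ) ^ 2 / 2) ≤ δ / 6 * (n : ℝ) ^ 2 := by
    have := mul_le_mul_of_nonneg_right hηδ (sq_nonneg (n : ℝ))
    have h3 : 0 ≤ L * (η * (N + 1)) * (n : ℝ) ^ 2 := by positivity
    nlinarith
  have h3 := mul_le_mul_of_nonneg_right hLδ (sq_nonneg (n : ℝ))
  rw [ha] at hlin
  linarith

theorem mainTheorem8 :
    ∃ r : ℕ → ℝ,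
      r =o[Filter.atTop] (fun n : ℕ => (n : ℝ) ^ 2) ∧
      ∀ n : ℕ, volume (metricPolytope n) =
        ENNReal.ofReal ((1 / 2 : ℝ) ^ ((n.choose 2 : ℝ) + r n)) := by
  have hfin : ∀ n, volume (metricPolytope n) ≠ ⊤ := fun n => by
    refine ne_top_of_le_ne_top ?_ (measure_mono (t := Set.pi Set.univ
      fun _ : CompleteEdge n => Set.Icc (0 : ℝ) 1) fun d hd e _ => hd.1 e)
    rw [volume_pi_pi]
    simp
  set w : ℕ → ℝ := fun n => (volume (metricPolytope n)).toReal with hw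
  have hvol : ∀ n, volume (metricPolytope n) = ENNReal.ofReal (w n) := fun n =>
    (ENNReal.ofReal_toReal (hfin n)).symm
  have hlow : ∀ n, (1 / 2 : ℝ) ^ n.choose 2 ≤ w n := fun n =>
    (ENNReal.ofReal_le_iff_le_toReal (hfin n)).1 (half_pow_le_volume_metricPolytope n)
  have hpos : ∀ n, 0 < w n := fun n => lt_of_lt_of_le (by positivity) (hlow n)
  have hlog2 : 0 < Real.log 2 := Real.log_pos (by norm_num)
  have hloghalf : Real.log (1 / 2) = -Real.log 2 := by rw [one_div, Real.log_inv]
  -- This is the only possible exponent, meaningful because the volume is positive. The lower bound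
  -- on the volume gives r ≤ 0, the upper bound gives r ≥ −cn² eventually.
  refine ⟨fun n => -Real.log (w n) / Real.log 2 - n.choose 2, ?_, fun n => ?_⟩
  · rw [isLittleO_iff]
    intro c hc
    obtain ⟨n₀, h⟩ := volume_metricPolytope_le_eventually (mul_pos hc hlog2)
    filter_upwards [Filter.eventually_ge_atTop n₀] with n hn
    have h1 : w n ≤ (1 / 2) ^ n.choose 2 * Real.exp (c * Real.log 2 * (n : ℝ) ^ 2) :=
      ENNReal.toReal_le_of_le_ofReal (by positivity) (h n hn)
    have h2 := Real.log_le_log (hpos n) h1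
    have h3 := Real.log_le_log (by positivity) (hlow n)
    rw [Real.log_mul (by positivity) (Real.exp_pos _).ne', Real.log_exp, Real.log_pow,
      hloghalf] at h2
    rw [Real.log_pow, hloghalf] at h3
    rw [Real.norm_of_nonneg (sq_nonneg (n : ℝ)), Real.norm_eq_abs, abs_le]
    constructor
    · rw [le_sub_iff_add_le, le_div_iff₀ hlog2]
      linarith
    · have h4 : 0 ≤ c * (n : ℝ) ^ 2 := by positivity
      refine le_trans ?_ h4
      rw [sub_nonpos, div_le_iff₀ hlog2]
      linarith
  · rw [hvol]
    congr 1
    rw [Real.rpow_def_of_pos (by norm_num), hloghalf]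
    simp only [add_sub_cancel]
    rw [neg_mul, mul_div_cancel₀ _ hlog2.ne', neg_neg, Real.exp_log (hpos n)]
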